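/- There is a numerical constant $c>0$ with the following property. Let $\mathcal H$ be a finite-dimensional complex Hilbert space and let $\eta$ be a faithful state on $\mathcal H$, i.e. a positive definite operator with $\operatorname{Tr}\eta=1$, with spectral decomposition $\eta=\sum_i\mu_i p_i$, where the $\mu_i$ are the distinct eigenvalues of $\eta$ and the $p_i$ the associated spectral projections. Put \[ C_\eta = c\,\dim\mathcal H\,\frac{\log 2-\log\inf\mathrm{sp}\,\eta}{(\inf\mathrm{sp}\,\eta)^4}>0 . \] Then there is a constant $D_\eta>0$, depending only on $\eta$, such that for all operators $D_1,D_2$ on $\mathcal H$ (not necessarily self-adjoint) with $\operatorname{Tr}D_1=\operatorname{Tr}D_2=0$ and $\|D_1\|\le D_\eta$, $\|D_2\|\le D_\eta$ (operator norm), $\log(\eta+D_1)$ and $\log(\eta+D_2)$ are well defined by the holomorphic functional calculus of the principal logarithm (over a circle around the spectrum whose closed disc avoids $(-\infty,0]$), and the relative entropy $S(\rho|\nu)=\operatorname{Tr}\big(\rho(\log\rho-\log\nu)\big)$ satisfies \[ \big|S(\eta+D_1|\eta+D_2)-F_\eta(D_1-D_2)\big|\le C_\eta\,(\|D_1\|+\|D_2\|)^3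 , \] where $F_\eta(A)=F_\eta(A,A)$ and \[ F_\eta(A,B)=\sum_i\operatorname{Tr}(A p_i B p_i)\,\frac1{2\mu_i}+\sum_{i<j}\operatorname{Tr}(A p_j B p_i)\,\frac{\log\mu_i-\log\mu_j}{\mu_i-\mu_j}. \] -/

import Mathlib

open scoped BigOperators

noncomputable section

namespace EntropyPerturbation

variable {H : Type*} [NormedAddCommGroup H] [InnerProductSpace ℂ H]

/-- The trace of an operator. -/
def tr (A : H →L[ℂ] H) : ℂ := LinearMap.trace ℂ H (A : H →ₗ[ℂ] H)

/-- A faithful state: a positive definite self-adjoint operator of trace one. -/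
structure IsFaithfulState [CompleteSpace H] (η : H →L[ℂ] H) : Prop where
  selfAdjoint : IsSelfAdjoint η
  posDef : ∀ x : H, x ≠ 0 → 0 < (inner ℂ x (η x)).re
  trace_one : tr η = 1

/-- `η = ∑ i, μ i • p i`, where `μ` lists the distinct eigenvalues of `η` and the `p i` are the
associated (nonzero, orthogonal) spectral projections. -/
structure IsSpectralDecomposition [CompleteSpace H] (η : H →L[ℂ] H) {n : ℕ}
    (μ : Fin n → ℝ) (p : Fin n → H →L[ℂ] H) : Prop where
  injective : Function.Injective μ
  projection : ∀ i, IsStarProjection (p i)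
  ne_zero : ∀ i, p i ≠ 0
  orthogonal : ∀ i j, i ≠ j → p i * p j = 0
  sum_eq_one : ∑ i, p i = 1
  eq_sum : η = ∑ i, (μ i : ℂ) • p i

/-- The infimum of the spectrum (meant for self-adjoint operators, whose spectrum is real). -/
def infSp (η : H →L[ℂ] H) : ℝ := sInf (spectrum ℝ η)

/-- The circle of centre `c` and radius `r` is an admissible contour for the holomorphic functional
calculus of the principal logarithm at `M`: it encircles the spectrum of `M`, and the closed disc
that it bounds lies in the domain `ℂ \ (-∞, 0]` of the logarithm. -/
def IsLogContour (M : H →L[ℂ] H) (c : ℂ) (r : ℝ) : Prop :=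
  0 < r ∧ Metric.closedBall c r ⊆ Complex.slitPlane ∧ spectrum ℂ M ⊆ Metric.ball c r

/-- There is an admissible circle. This holds, in finite dimension, whenever the spectrum of `M`
lies in the open right half-plane. -/
def HasLog (M : H →L[ℂ] H) : Prop := ∃ γ : ℂ × ℝ, IsLogContour M γ.1 γ.2

open Classical in
/-- The logarithm of a (not necessarily self-adjoint) operator, by the holomorphic (Dunford-Taylor)
functional calculus: `log M = (2πi)⁻¹ ∮ log ζ (ζ - M)⁻¹ dζ` over an admissible circle. By Cauchy's
theorem the value does not depend on which admissible circle is taken. -/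
def opLog (M : H →L[ℂ] H) : H →L[ℂ] H :=
  if h : HasLog M then
    (2 * (Real.pi : ℂ) * Complex.I)⁻¹ •
      ∮ ζ in C(h.choose.1, h.choose.2), Complex.log ζ • resolvent M ζ
  else 0

/-- The relative entropy `S(ρ|ν) = Tr (ρ (log ρ - log ν))`. -/
def relEntropy (ρ ν : H →L[ℂ] H) : ℂ := tr (ρ * (opLog ρ - opLog ν))

/-- The bilinear form `F_η(A, B)`, written with the spectral data of `η`. -/
def bilinF {n : ℕ} (μ : Fin n → ℝ) (p : Fin n → H →L[ℂ] H) (A B : H →L[ℂ] H) : ℂ :=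
  ∑ i, tr (A * p i * B * p i) * ((1 / (2 * μ i) : ℝ) : ℂ) +
    ∑ i, ∑ j ∈ Finset.Ioi i,
      tr (A * p j * B * p i) * (((Real.log (μ i) - Real.log (μ j)) / (μ i - μ j) : ℝ) : ℂ)

/-- The quadratic form `F_η(A) = F_η(A, A)`. -/
def quadF {n : ℕ} (μ : Fin n → ℝ) (p : Fin n → H →L[ℂ] H) (A : H →L[ℂ] H) : ℂ :=
  bilinF μ p A A

/-- `C_η = c · dim H · (log 2 - log inf sp η) / (inf sp η)⁴`. -/
def constC (c : ℝ) (η : H →L[ℂ] H) : ℝ :=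
  c * (Module.finrank ℂ H : ℝ) * ((Real.log 2 - Real.log (infSp η)) / infSp η ^ 4)

end EntropyPerturbation

end

/-! The Dunford-Taylor logarithm is replaced by an integral over the segment from `1` to `M`, `log M
= ∫₀¹ (1 + t(M - 1))⁻¹ (M - 1) dt` (`opLog_eq_integral`). With `B = (1 - t + tη)⁻¹` and `V = (1 - t
+ t(η + D))⁻¹`, the identity `V = B - t V D B`, iterated, expands the integrand at `M = η + D` to
second order with an exact cubic remainder (`left_inverse_mul_eq`).

Let `K(X, Y) = ∫ Tr(X B Y B) dt`. In `Tr((η + D₁)(log(η + D₁) - log(η + D₂)))` the zeroth order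
cancels. The first order integrates to `Tr(D₁ - D₂) = 0`, since `B` commutes with `η`. The second
order is `K(D₁, D₁ - D₂) - K(D₁, D₁)/2 + K(D₂, D₂)/2 = K(D₁ - D₂, D₁ - D₂)/2`, where the halves come
from a symmetrisation in the spectral indices (`integral_tr_second_order`). In the spectral basis
the coefficients of `K` are divided differences of `log`, so `K(X, X)/2` is the form `F_η`
(`kernelForm_self`).

With `m = inf sp η`, the bounds `‖B‖ ≤ 1/m` and `‖V‖ ≤ 2/m` make what is left `O(m⁻⁴ (‖D₁‖ +
‖D₂‖)³)` in norm, and the trace costs a factor `dim H`. -/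

section LogarithmIntegral

/-! ### The holomorphic logarithm as a segment integral -/

open Metric Filter Topology Set

variable {A : Type*} [NormedRing A] [NormedAlgebra ℂ A] [CompleteSpace A]

theorem differentiableAt_resolvent {a : A} {z : ℂ} (hz : z ∉ spectrum ℂ a) :
    DifferentiableAt ℂ (resolvent a) z :=
  (spectrum.hasDerivAt_resolvent_const_left (𝕜 := ℂ) (spectrum.notMem_iff.mp hz)).differentiableAt

theorem sub_smul_one_mul_resolvent {A : Type*} [Ring A] [Algebra ℂ A] {a : A} {z : ℂ}
    (hz : z ∉ spectrum ℂ a) :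
    (z • (1 : A) - a) * resolvent a z = 1 := by
  have h := spectrum.notMem_iff.mp hz
  rw [← Algebra.algebraMap_eq_smul_one]
  exact Ring.mul_inverse_cancel _ h

/-- The resolvent integrates to `2πi` over a circle around the spectrum. -/
theorem circleIntegral_resolvent (a : A) {c : ℂ} {r : ℝ} (hr : 0 < r)
    (h : spectrum ℂ a ⊆ ball c r) :
    ∮ ζ in C(c, r), resolvent a ζ = (2 * (Real.pi : ℂ) * Complex.I) • (1 : A) := by
  have hns : ∀ z, z ∉ ball c r → z ∉ spectrum ℂ a := fun z hz hz' => hz (h hz')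
  have hindep : ∀ R, r ≤ R →
      (∮ ζ in C(c, R), resolvent a ζ) = ∮ ζ in C(c, r), resolvent a ζ := by
    intro R hR
    refine Complex.circleIntegral_eq_of_differentiable_on_annulus_off_countable hr hR
      countable_empty ?_ ?_
    · exact fun z hz => (differentiableAt_resolvent (hns z hz.2)).continuousAt.continuousWithinAt
    · exact fun z hz => differentiableAt_resolvent
        (hns z fun hb => hz.1.2 (ball_subset_closedBall hb))
  -- Comparison with the scalar integral of `(ζ - c)⁻¹`. The difference has integrand `R⁻¹ · o(1)`
  -- in norm on the circle of radius `R`, hence vanishes as `R → ∞`.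
  have hdiff : ∀ R, r ≤ R → (∮ ζ in C(c, r), resolvent a ζ) -
      (2 * (Real.pi : ℂ) * Complex.I) • (1 : A) =
        ∮ ζ in C(c, R), (ζ - c)⁻¹ • ((a - c • 1) * resolvent a ζ) := by
    intro R hR
    have hR0 : 0 < R := hr.trans_le hR
    have hcont : ContinuousOn (resolvent a) (sphere c R) := fun z hz =>
      (differentiableAt_resolvent (hns z fun hb => by
        rw [mem_sphere] at hz; rw [mem_ball] at hb; linarith)).continuousAt.continuousWithinAt
    have hcont' : ContinuousOn (fun z : ℂ => (z - c)⁻¹ • (1 : A)) (sphere c R) :=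
      ContinuousOn.smul (ContinuousOn.inv₀ (by fun_prop) fun z hz hzc => by
        rw [mem_sphere, sub_eq_zero.mp hzc, dist_self] at hz; exact hR0.ne hz) continuousOn_const
    rw [← hindep R hR, ← circleIntegral.integral_sub_center_inv c hR0.ne',
      ← circleIntegral.integral_smul_const, ← circleIntegral.integral_sub
        (hcont.circleIntegrable hR0.le) (hcont'.circleIntegrable hR0.le)]
    refine circleIntegral.integral_congr hR0.le fun z hz => ?_
    have hzc : z - c ≠ 0 := fun hzc => by
      rw [mem_sphere, sub_eq_zero.mp hzc, dist_self] at hz; exact hR0.ne hz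
    have hres := sub_smul_one_mul_resolvent (a := a) (hns z fun hb => by
        rw [mem_sphere] at hz; rw [mem_ball] at hb; linarith)
    have : (a - c • 1) * resolvent a z = (z - c) • resolvent a z - 1 := by
      conv_rhs => rw [← hres]
      simp only [sub_mul, smul_mul_assoc, one_mul, sub_smul]; abel
    simp only [this, smul_sub, inv_smul_smul₀ hzc]
  rw [← sub_eq_zero, ← norm_le_zero_iff]
  refine le_of_forall_pos_le_add fun ε hε => ?_
  have hlim : Tendsto (fun z => (a - c • 1) * resolvent a z) (Bornology.cobounded ℂ) (𝓝 0) := by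
    simpa using (spectrum.resolvent_tendsto_cobounded (𝕜 := ℂ) a).const_mul (a - c • 1)
  have hev := hlim.eventually (ball_mem_nhds (0 : A) (show 0 < ε / (2 * Real.pi) by positivity))
  obtain ⟨R₀, -, hR₀⟩ := (hasBasis_cobounded_compl_closedBall c).eventually_iff.mp hev
  set R := max r (R₀ + 1)
  have hR0 : 0 < R := hr.trans_le (le_max_left _ _)
  rw [hdiff R (le_max_left _ _), zero_add]
  calc _ ≤ 2 * Real.pi * R * (R⁻¹ * (ε / (2 * Real.pi))) := by
        refine circleIntegral.norm_integral_le_of_norm_le_const hR0.le fun z hz => ?_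
        have h1 : ‖z - c‖ = R := by rw [← dist_eq_norm]; exact hz
        rw [norm_smul, norm_inv, h1]
        gcongr
        have := hR₀ (x := z) (by
          simp only [mem_compl_iff, mem_closedBall, not_le, dist_eq_norm, h1]
          exact lt_of_lt_of_le (by linarith) (le_max_right r (R₀ + 1)))
        exact (mem_ball_zero_iff.mp this).le
    _ = ε := by field_simp

theorem one_add_smul_sub_one_mem_slitPlane {z : ℂ} (hz : z ∈ Complex.slitPlane) {t : ℝ}
    (ht : t ∈ Icc (0 : ℝ) 1) : 1 + (t : ℂ) * (z - 1) ∈ Complex.slitPlane := by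
  have := StarConvex.add_smul_mem Complex.starConvex_one_slitPlane (y := z - 1)
    (by simpa using hz) ht.1 ht.2
  simpa using this

/-- For `t > 0` the element is `-t((1 - 1/t) - a)`, and `1 - 1/t ≤ 0` lies outside the slit plane,
hence outside the spectrum. -/
theorem isUnit_one_add_smul_sub_one {A : Type*} [Ring A] [Algebra ℂ A] {a : A}
    (ha : spectrum ℂ a ⊆ Complex.slitPlane) {t : ℝ} (ht : t ∈ Icc (0 : ℝ) 1) :
    IsUnit (1 + (t : ℂ) • (a - 1)) := by
  rcases ht.1.eq_or_lt with rfl | ht0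
  · simp
  have hz : ((1 - t⁻¹ : ℝ) : ℂ) ∉ spectrum ℂ a := fun hmem => by
    have := ha hmem
    rw [Complex.ofReal_mem_slitPlane, sub_pos] at this
    exact absurd ((one_le_inv₀ ht0).mpr ht.2) this.not_ge
  have hu := spectrum.notMem_iff.mp hz
  have hne : (-(t : ℂ)) ≠ 0 := by simpa using ht0.ne'
  have := hu.smul (Units.mk0 _ hne)
  convert this using 1
  have : (t : ℂ) ≠ 0 := by simpa using ht0.ne'
  rw [Units.smul_mk0, Algebra.algebraMap_eq_smul_one, smul_sub (-(t : ℂ)), smul_smul]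
  push_cast
  rw [show -(t : ℂ) * (1 - (t : ℂ)⁻¹) = 1 - t by field_simp; ring]
  rw [smul_sub, sub_smul, neg_smul, one_smul]; abel

/-- With `f(ζ) = (ζ - 1)/(1 + t(ζ - 1))`, the function `(f(ζ) - f(a))(ζ - a)⁻¹` extends
holomorphically to the disc: it equals `(1 + t(ζ - 1))⁻¹ V`. Only the constant `f(a) = V(a - 1)`
times the resolvent contributes. -/
theorem circleIntegral_smul_resolvent (a : A) {c : ℂ} {r : ℝ} (hr : 0 < r)
    (hs : closedBall c r ⊆ Complex.slitPlane) (h : spectrum ℂ a ⊆ ball c r) {t : ℝ}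
    (ht : t ∈ Icc (0 : ℝ) 1) :
    ∮ ζ in C(c, r), ((ζ - 1) * (1 + (t : ℂ) * (ζ - 1))⁻¹) • resolvent a ζ =
      (2 * (Real.pi : ℂ) * Complex.I) • (Ring.inverse (1 + (t : ℂ) • (a - 1)) * (a - 1)) := by
  set V := Ring.inverse (1 + (t : ℂ) • (a - 1)) with hV
  have hVU : V * (1 + (t : ℂ) • (a - 1)) = 1 := Ring.inverse_mul_cancel _
    (isUnit_one_add_smul_sub_one ((h.trans ball_subset_closedBall).trans hs) ht)
  have hne : ∀ z ∈ closedBall c r, 1 + (t : ℂ) * (z - 1) ≠ 0 := fun z hz =>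
    Complex.slitPlane_ne_zero (one_add_smul_sub_one_mem_slitPlane (hs hz) ht)
  have hns : ∀ z ∈ sphere c r, z ∉ spectrum ℂ a := fun z hz hz' => by
    have := h hz'
    rw [mem_sphere] at hz; rw [mem_ball] at this; linarith
  have hdiff : DifferentiableOn ℂ (fun z : ℂ => (1 + (t : ℂ) * (z - 1))⁻¹ • V) (closedBall c r) :=
    DifferentiableOn.smul_const (DifferentiableOn.inv (by fun_prop) hne) V
  have hzero : ∮ ζ in C(c, r), (1 + (t : ℂ) * (ζ - 1))⁻¹ • V = 0 :=
    Complex.circleIntegral_eq_zero_of_differentiable_on_off_countable hr.le countable_empty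
      hdiff.continuousOn fun z hz => (hdiff z (ball_subset_closedBall hz.1)).differentiableAt
        (mem_of_superset (isOpen_ball.mem_nhds hz.1) ball_subset_closedBall)
  have hcont : ContinuousOn (resolvent a) (sphere c r) := fun z hz =>
    (differentiableAt_resolvent (hns z hz)).continuousAt.continuousWithinAt
  have hsplit : EqOn (fun ζ => ((ζ - 1) * (1 + (t : ℂ) * (ζ - 1))⁻¹) • resolvent a ζ)
      (fun ζ => V * (a - 1) * resolvent a ζ + (1 + (t : ℂ) * (ζ - 1))⁻¹ • V) (sphere c r) := by
    intro z hz
    have hu := hne z (sphere_subset_closedBall hz)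
    have hres := sub_smul_one_mul_resolvent (a := a) (hns z hz)
    have h1 : z • (1 : A) - a = (z - 1) • (1 + (t : ℂ) • (a - 1)) -
        (1 + (t : ℂ) * (z - 1)) • (a - 1) := by module
    have h2 : V = (z - 1) • resolvent a z -
        (1 + (t : ℂ) * (z - 1)) • (V * (a - 1) * resolvent a z) := by
      calc V = V * ((z • (1 : A) - a) * resolvent a z) := by rw [hres, mul_one]
        _ = _ := by
          rw [h1, ← mul_assoc, mul_sub, mul_smul_comm, hVU, mul_smul_comm, sub_mul, smul_mul_assoc,
            smul_mul_assoc, one_mul]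
    have h3 : (1 + (t : ℂ) * (z - 1))⁻¹ • V = ((z - 1) * (1 + (t : ℂ) * (z - 1))⁻¹) • resolvent a z
        - V * (a - 1) * resolvent a z := by
      conv_lhs => rw [h2]
      rw [smul_sub, inv_smul_smul₀ hu, smul_smul, mul_comm]
    simp only [h3]; abel
  have hcont' : ContinuousOn (fun ζ => V * (a - 1) * resolvent a ζ) (sphere c r) :=
    continuousOn_const.mul hcont
  rw [circleIntegral.integral_congr hr.le hsplit, circleIntegral.integral_add
    (hcont'.circleIntegrable hr.le)
    ((hdiff.continuousOn.mono sphere_subset_closedBall).circleIntegrable hr.le), hzero, add_zero]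
  have hL : (∮ ζ in C(c, r), V * (a - 1) * resolvent a ζ) =
      V * (a - 1) * ∮ ζ in C(c, r), resolvent a ζ := by
    simp only [circleIntegral]
    have := ContinuousLinearMap.intervalIntegral_comp_comm (μ := MeasureTheory.volume)
      (ContinuousLinearMap.mul ℂ A (V * (a - 1))) (hcont.circleIntegrable hr.le).out
    simpa using this
  rw [hL, circleIntegral_resolvent a hr h, mul_smul_comm, mul_one]

/-- The Dunford-Taylor integral of the principal logarithm over an admissible circle, as an
integral along the segment from `1` to `a`. -/
theorem circleIntegral_log_smul_resolvent (a : A) {c : ℂ} {r : ℝ} (hr : 0 < r)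
    (hs : closedBall c r ⊆ Complex.slitPlane) (h : spectrum ℂ a ⊆ ball c r) :
    ∮ ζ in C(c, r), Complex.log ζ • resolvent a ζ = (2 * (Real.pi : ℂ) * Complex.I) •
      ∫ t in (0 : ℝ)..1, Ring.inverse (1 + (t : ℂ) • (a - 1)) * (a - 1) := by
  have hmem : ∀ θ, circleMap c r θ ∈ sphere c r := fun θ => circleMap_mem_sphere c hr.le θ
  set F : ℝ → ℝ → A := fun θ t => deriv (circleMap c r) θ •
    (((circleMap c r θ - 1) * (1 + (t : ℂ) * (circleMap c r θ - 1))⁻¹) •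
      resolvent a (circleMap c r θ)) with hF
  have hcres : Continuous fun θ => resolvent a (circleMap c r θ) := by
    refine continuous_iff_continuousAt.mpr fun θ => ?_
    have : circleMap c r θ ∉ spectrum ℂ a := fun hz => by
      have h1 := h hz
      have h2 := hmem θ
      rw [mem_sphere] at h2; rw [mem_ball] at h1; linarith
    exact ContinuousAt.comp (f := circleMap c r) (differentiableAt_resolvent this).continuousAt
      (continuous_circleMap c r).continuousAt
  have hcF : ContinuousOn F.uncurry (Icc 0 (2 * Real.pi) ×ˢ Icc (0 : ℝ) 1) := by
    have hm : Continuous fun x : ℝ × ℝ => circleMap c r x.1 :=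
      (continuous_circleMap c r).comp continuous_fst
    refine ContinuousOn.smul ?_ (ContinuousOn.smul (ContinuousOn.mul (by fun_prop)
      (ContinuousOn.inv₀ (by fun_prop) ?_)) (hcres.comp continuous_fst).continuousOn)
    · have : Continuous fun x : ℝ × ℝ => circleMap 0 r x.1 :=
        (continuous_circleMap 0 r).comp continuous_fst
      simp only [deriv_circleMap]
      fun_prop
    · exact fun x hx => Complex.slitPlane_ne_zero (one_add_smul_sub_one_mem_slitPlane
        (hs (sphere_subset_closedBall (hmem _))) hx.2)
  have hint : MeasureTheory.IntegrableOn F.uncurry (uIoc 0 (2 * Real.pi) ×ˢ uIoc (0 : ℝ) 1) := by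
    refine (hcF.integrableOn_compact (isCompact_Icc.prod isCompact_Icc)).mono_set ?_
    rw [uIoc_of_le Real.two_pi_pos.le, uIoc_of_le zero_le_one]
    exact prod_mono Ioc_subset_Icc_self Ioc_subset_Icc_self
  calc ∮ ζ in C(c, r), Complex.log ζ • resolvent a ζ
      = ∫ θ in (0 : ℝ)..2 * Real.pi, ∫ t in (0 : ℝ)..1, F θ t := by
        rw [circleIntegral]
        refine intervalIntegral.integral_congr fun θ _ => ?_
        -- The scalar formula `log z = (z - 1) ∫₀¹ (1 + t(z - 1))⁻¹ dt` turns the contour integral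
        -- into a double integral.
        have hz : 1 + (circleMap c r θ - 1) ∈ Complex.slitPlane := by
          simpa using hs (sphere_subset_closedBall (hmem θ))
        have hlog := Complex.log_eq_integral hz
        rw [add_sub_cancel] at hlog
        simp only [hF, intervalIntegral.integral_smul, intervalIntegral.integral_smul_const,
          intervalIntegral.integral_const_mul]
        rw [hlog]
        simp
    _ = ∫ t in (0 : ℝ)..1, ∫ θ in (0 : ℝ)..2 * Real.pi, F θ t :=
        MeasureTheory.intervalIntegral_intervalIntegral_swap hint
    _ = ∫ t in (0 : ℝ)..1, (2 * (Real.pi : ℂ) * Complex.I) •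
          (Ring.inverse (1 + (t : ℂ) • (a - 1)) * (a - 1)) := by
        refine intervalIntegral.integral_congr fun t ht => ?_
        rw [uIcc_of_le zero_le_one] at ht
        exact circleIntegral_smul_resolvent a hr hs h ht
    _ = _ := intervalIntegral.integral_smul _ _

theorem continuousOn_inverse_one_add_smul_sub_one {a : A}
    (ha : spectrum ℂ a ⊆ Complex.slitPlane) :
    ContinuousOn (fun t : ℝ => Ring.inverse (1 + (t : ℂ) • (a - 1))) (Icc 0 1) := by
  intro t ht
  obtain ⟨u, hu⟩ := isUnit_one_add_smul_sub_one ha ht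
  have h1 := NormedRing.inverse_continuousAt u
  rw [hu] at h1
  exact (ContinuousAt.comp (f := fun t : ℝ => 1 + (t : ℂ) • (a - 1)) h1
    (by fun_prop)).continuousWithinAt

end LogarithmIntegral

noncomputable section

namespace EntropyPerturbation

/-! ### Scalar kernel integrals -/

section Scalar

open Set

/-- The scalar kernel `1 / (1 - t + t x)`. -/
def kernel (x t : ℝ) : ℝ := (1 + t * (x - 1))⁻¹

variable {x y t : ℝ}

theorem le_one_add_mul_sub_one {m : ℝ} (hm1 : m ≤ 1) (hx : m ≤ x) (ht : t ∈ Icc (0 : ℝ) 1) :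
    m ≤ 1 + t * (x - 1) := by
  nlinarith [mul_nonneg ht.1 (sub_nonneg.mpr hx),
    mul_nonneg (sub_nonneg.mpr ht.2) (sub_nonneg.mpr hm1)]

theorem one_add_mul_sub_one_pos (hx : 0 < x) (ht : t ∈ Icc (0 : ℝ) 1) :
    0 < 1 + t * (x - 1) :=
  (lt_min hx one_pos).trans_le (by
    nlinarith [mul_nonneg ht.1 (sub_nonneg.mpr (min_le_left x 1)),
      mul_nonneg (sub_nonneg.mpr ht.2) (sub_nonneg.mpr (min_le_right x 1))])

theorem continuousOn_kernel (hx : 0 < x) : ContinuousOn (kernel x) (uIcc 0 1) := by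
  rw [uIcc_of_le zero_le_one]
  exact ContinuousOn.inv₀ (by fun_prop) fun t ht => (one_add_mul_sub_one_pos hx ht).ne'

theorem intervalIntegrable_kernel_mul_kernel (hx : 0 < x) (hy : 0 < y) :
    IntervalIntegrable (fun t => kernel x t * kernel y t) MeasureTheory.volume 0 1 :=
  ((continuousOn_kernel hx).mul (continuousOn_kernel hy)).intervalIntegrable

theorem hasDerivAt_kernel (hx : 0 < x) (ht : t ∈ Icc (0 : ℝ) 1) :
    HasDerivAt (kernel x) (-(x - 1) * kernel x t ^ 2) t := by
  have h0 := (one_add_mul_sub_one_pos hx ht).ne'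
  have h1 : HasDerivAt (fun t : ℝ => 1 + t * (x - 1)) (x - 1) t := by
    simpa using ((hasDerivAt_id t).mul_const (x - 1)).const_add 1
  refine (h1.inv h0).congr_deriv ?_
  simp only [kernel]; field_simp

theorem integral_kernel_sq (hx : 0 < x) : ∫ t in (0 : ℝ)..1, kernel x t * kernel x t = 1 / x := by
  -- The antiderivative `t k` works because `k' = -(x - 1) k²` and `k = (1 + t(x - 1)) k²`. It also
  -- covers `x = 1`.
  rw [intervalIntegral.integral_eq_sub_of_hasDerivAt (f := fun t => t * kernel x t) _
    (intervalIntegrable_kernel_mul_kernel hx hx)]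
  · simp [kernel]
  · intro t ht
    rw [uIcc_of_le zero_le_one] at ht
    have h0 := (one_add_mul_sub_one_pos hx ht).ne'
    refine ((hasDerivAt_id t).mul (hasDerivAt_kernel hx ht)).congr_deriv ?_
    simp only [kernel, id]; field_simp; ring

theorem integral_kernel_mul_kernel (hx : 0 < x) (hy : 0 < y) (hxy : x ≠ y) :
    ∫ t in (0 : ℝ)..1, kernel x t * kernel y t = (Real.log x - Real.log y) / (x - y) := by
  have hxy' : x - y ≠ 0 := sub_ne_zero.mpr hxy
  rw [intervalIntegral.integral_eq_sub_of_hasDerivAt (f := fun t =>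
    (Real.log (1 + t * (x - 1)) - Real.log (1 + t * (y - 1))) / (x - y)) _
    (intervalIntegrable_kernel_mul_kernel hx hy)]
  · simp
  · intro t ht
    rw [uIcc_of_le zero_le_one] at ht
    have h0 := (one_add_mul_sub_one_pos hx ht).ne'
    have h0' := (one_add_mul_sub_one_pos hy ht).ne'
    have hd : ∀ z : ℝ, HasDerivAt (fun t : ℝ => 1 + t * (z - 1)) (z - 1) t := fun z => by
      simpa using ((hasDerivAt_id t).mul_const (z - 1)).const_add 1
    refine ((((hd x).log h0).sub ((hd y).log h0')).div_const (x - y)).congr_deriv ?_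
    simp only [kernel]
    rw [eq_comm, eq_div_iff hxy', div_sub_div _ _ h0 h0', eq_div_iff (mul_ne_zero h0 h0'),
      ← mul_inv, mul_right_comm, inv_mul_cancel₀ (mul_ne_zero h0 h0')]
    ring

theorem continuousOn_mul_kernel (hx : 0 < x) (hy : 0 < y) :
    ContinuousOn (fun t => t * (x * (kernel x t * kernel x t)) * kernel y t) (uIcc 0 1) :=
  (continuousOn_id.mul (continuousOn_const.mul
    ((continuousOn_kernel hx).mul (continuousOn_kernel hx)))).mul (continuousOn_kernel hy)

/-- The difference of the integrands is the derivative of `-t(1 - t) k_x k_y`, which vanishes at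
both endpoints. This removes the weight `t` from the second-order terms. -/
theorem integral_mul_kernel_add_swap (hx : 0 < x) (hy : 0 < y) :
    (∫ t in (0 : ℝ)..1, t * (x * (kernel x t * kernel x t)) * kernel y t) +
      ∫ t in (0 : ℝ)..1, t * (y * (kernel y t * kernel y t)) * kernel x t =
      ∫ t in (0 : ℝ)..1, kernel x t * kernel y t := by
  have h1 := (continuousOn_mul_kernel hx hy).intervalIntegrable (μ := MeasureTheory.volume)
  have h2 := (continuousOn_mul_kernel hy hx).intervalIntegrable (μ := MeasureTheory.volume)
  have h3 := intervalIntegrable_kernel_mul_kernel hx hy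
  rw [← sub_eq_zero, ← intervalIntegral.integral_add h1 h2,
    ← intervalIntegral.integral_sub (h1.add h2) h3,
    intervalIntegral.integral_eq_sub_of_hasDerivAt
      (f := fun t => -(t * (1 - t) * (kernel x t * kernel y t))) _ ((h1.add h2).sub h3)]
  · simp
  · intro t ht
    rw [uIcc_of_le zero_le_one] at ht
    have h0 := (one_add_mul_sub_one_pos hx ht).ne'
    have h0' := (one_add_mul_sub_one_pos hy ht).ne'
    refine (((hasDerivAt_id t).mul ((hasDerivAt_id t).const_sub 1)).mul
      ((hasDerivAt_kernel hx ht).mul (hasDerivAt_kernel hy ht))).neg.congr_deriv ?_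
    simp only [kernel, id, Pi.mul_apply]; field_simp; ring

end Scalar

/-! ### The trace as a bounded functional -/

section Trace

variable {H : Type*} [NormedAddCommGroup H] [InnerProductSpace ℂ H]

theorem tr_mul_comm (X Y : H →L[ℂ] H) : tr (X * Y) = tr (Y * X) :=
  LinearMap.trace_mul_comm ℂ (X : H →ₗ[ℂ] H) (Y : H →ₗ[ℂ] H)

theorem norm_tr_le [FiniteDimensional ℂ H] (X : H →L[ℂ] H) :
    ‖tr X‖ ≤ Module.finrank ℂ H * ‖X‖ := by
  rw [tr, LinearMap.trace_eq_sum_inner _ (stdOrthonormalBasis ℂ H)]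
  calc _ ≤ ∑ _i : Fin (Module.finrank ℂ H), ‖X‖ := by
        refine norm_sum_le_of_le _ fun i _ => (norm_inner_le_norm _ _).trans ?_
        simpa using X.le_opNorm (stdOrthonormalBasis ℂ H i)
    _ = _ := by simp

/-- The trace as a continuous linear functional. -/
def trCLM (H : Type*) [NormedAddCommGroup H] [InnerProductSpace ℂ H] [FiniteDimensional ℂ H] :
    (H →L[ℂ] H) →L[ℂ] ℂ :=
  LinearMap.mkContinuous
    { toFun := tr
      map_add' := fun X Y => by simp [tr]
      map_smul' := fun c X => by simp [tr] } (Module.finrank ℂ H) norm_tr_le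

variable [FiniteDimensional ℂ H]

theorem tr_add (X Y : H →L[ℂ] H) : tr (X + Y) = tr X + tr Y := (trCLM H).map_add X Y
theorem tr_sub (X Y : H →L[ℂ] H) : tr (X - Y) = tr X - tr Y := (trCLM H).map_sub X Y
theorem tr_smul (c : ℂ) (X : H →L[ℂ] H) : tr (c • X) = c * tr X := (trCLM H).map_smul c X
theorem tr_sum {ι : Type*} (s : Finset ι) (X : ι → H →L[ℂ] H) :
    tr (∑ i ∈ s, X i) = ∑ i ∈ s, tr (X i) := map_sum (trCLM H) X s

end Trace

/-! ### Spectrum of a faithful state -/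

section State

variable {H : Type*} [NormedAddCommGroup H] [InnerProductSpace ℂ H] {η : H →L[ℂ] H}

theorem mem_spectrum_real_iff_hasEigenvalue [FiniteDimensional ℂ H] (η : H →L[ℂ] H) (x : ℝ) :
    x ∈ spectrum ℝ η ↔ Module.End.HasEigenvalue (η : H →ₗ[ℂ] H) (x : ℂ) := by
  rw [Module.End.hasEigenvalue_iff_mem_spectrum, ← spectrum.algebraMap_mem_iff ℂ]
  have := AlgEquiv.spectrum_eq (Module.End.toContinuousLinearMap (𝕜 := ℂ) H) (η : H →ₗ[ℂ] H)
  rw [← this]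
  rfl

variable [CompleteSpace H]

theorem IsFaithfulState.isSymmetric (h : IsFaithfulState η) : (η : H →ₗ[ℂ] H).IsSymmetric :=
  h.selfAdjoint.isSymmetric

theorem IsFaithfulState.pos_of_hasEigenvalue (h : IsFaithfulState η) {x : ℝ}
    (hx : Module.End.HasEigenvalue (η : H →ₗ[ℂ] H) (x : ℂ)) : 0 < x := by
  obtain ⟨v, hv⟩ := hx.exists_hasEigenvector
  have h1 := h.posDef v hv.2
  have h2 : η v = (x : ℂ) • v := hv.apply_eq_smul
  have h3 : (inner ℂ v (η v)).re = x * ‖v‖ ^ 2 := by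
    rw [h2, inner_smul_right, inner_self_eq_norm_sq_to_K]
    simp [← Complex.ofReal_pow]
  rw [h3] at h1
  exact pos_of_mul_pos_left h1 (by positivity)

theorem IsFaithfulState.nontrivial (h : IsFaithfulState η) : Nontrivial H := by
  by_contra hn
  rw [not_nontrivial_iff_subsingleton] at hn
  have := h.trace_one
  rw [Subsingleton.elim η 0] at this
  simp [tr] at this

theorem isCompact_spectrum_real (η : H →L[ℂ] H) : IsCompact (spectrum ℝ η) :=
  spectrum.isCompact η

variable [FiniteDimensional ℂ H]

/-- The eigenvalues, counted with multiplicity, are positive and sum to the trace, which is one. -/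
theorem IsFaithfulState.le_one_of_hasEigenvalue (h : IsFaithfulState η) {x : ℝ}
    (hx : Module.End.HasEigenvalue (η : H →ₗ[ℂ] H) (x : ℂ)) : x ≤ 1 := by
  obtain ⟨i, hi⟩ := h.isSymmetric.exists_eigenvalues_eq rfl hx
  have hsum := h.isSymmetric.trace_eq_sum_eigenvalues rfl
  have htr : LinearMap.trace ℂ H (η : H →ₗ[ℂ] H) = 1 := h.trace_one
  rw [htr] at hsum
  have hsum' : ∑ j, h.isSymmetric.eigenvalues rfl j = 1 := 
    RCLike.ofReal_injective (K := ℂ) (by simpa using hsum.symm)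
  have hi' : h.isSymmetric.eigenvalues rfl i = x := RCLike.ofReal_injective (K := ℂ) hi
  rw [← hi', ← hsum']
  exact Finset.single_le_sum (f := h.isSymmetric.eigenvalues rfl)
    (fun j _ => (h.pos_of_hasEigenvalue (h.isSymmetric.hasEigenvalue_eigenvalues rfl j)).le)
    (Finset.mem_univ i)

theorem IsFaithfulState.infSp_mem (h : IsFaithfulState η) : infSp η ∈ spectrum ℝ η := by
  have := h.nontrivial
  refine (isCompact_spectrum_real η).sInf_mem ?_
  have hpos : 0 < Module.finrank ℂ H := Module.finrank_pos
  exact ⟨_, (mem_spectrum_real_iff_hasEigenvalue η _).mpr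
    (h.isSymmetric.hasEigenvalue_eigenvalues rfl ⟨0, hpos⟩)⟩

theorem IsFaithfulState.infSp_pos (h : IsFaithfulState η) : 0 < infSp η :=
  h.pos_of_hasEigenvalue ((mem_spectrum_real_iff_hasEigenvalue η _).mp h.infSp_mem)

theorem IsFaithfulState.infSp_le_one (h : IsFaithfulState η) : infSp η ≤ 1 :=
  h.le_one_of_hasEigenvalue ((mem_spectrum_real_iff_hasEigenvalue η _).mp h.infSp_mem)

theorem IsFaithfulState.constC_pos (h : IsFaithfulState η) {c : ℝ} (hc : 0 < c) :
    0 < constC c η := by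
  have := h.nontrivial
  have hdim : (0 : ℝ) < Module.finrank ℂ H := by exact_mod_cast Module.finrank_pos
  have hm := h.infSp_pos
  have hlog : Real.log (infSp η) < Real.log 2 :=
    Real.log_lt_log hm (h.infSp_le_one.trans_lt one_lt_two)
  have : 0 < Real.log 2 - Real.log (infSp η) := sub_pos.mpr hlog
  unfold constC
  positivity

end State

/-! ### Functional calculus on the spectral projections -/

section Decomposition

variable {H : Type*} [NormedAddCommGroup H] [InnerProductSpace ℂ H] [CompleteSpace H]
  {η : H →L[ℂ] H} {n : ℕ} {μ : Fin n → ℝ} {p : Fin n → H →L[ℂ] H}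

namespace IsSpectralDecomposition

theorem sum_smul_mul_sum_smul (h : IsSpectralDecomposition η μ p) (a b : Fin n → ℂ) :
    (∑ i, a i • p i) * ∑ i, b i • p i = ∑ i, (a i * b i) • p i := by
  rw [Finset.sum_mul_sum]
  refine Finset.sum_congr rfl fun i _ => ?_
  rw [Finset.sum_eq_single i]
  · rw [smul_mul_smul_comm, (h.projection i).isIdempotentElem.eq]
  · intro j _ hj
    rw [smul_mul_smul_comm, h.orthogonal i j hj.symm, smul_zero]
  · simp

theorem norm_sq_sum_smul_apply (h : IsSpectralDecomposition η μ p) (a : Fin n → ℂ) (x : H) :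
    ‖(∑ i, a i • p i) x‖ ^ 2 = ∑ i, ‖a i‖ ^ 2 * ‖p i x‖ ^ 2 := by
  have horth : ∀ i j, i ≠ j → inner ℂ (a i • p i x) (a j • p j x) = 0 := by
    intro i j hij
    have hsa : (p i).adjoint = p i := (h.projection i).isSelfAdjoint
    have h0 : p i (p j x) = 0 := by
      rw [← mul_apply_eq_comp, h.orthogonal i j hij]; rfl
    rw [inner_smul_left, inner_smul_right, ← hsa, ContinuousLinearMap.adjoint_inner_left, h0]
    simp
  have h1 : inner ℂ ((∑ i, a i • p i) x) ((∑ i, a i • p i) x) =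
      ((∑ i, ‖a i‖ ^ 2 * ‖p i x‖ ^ 2 : ℝ) : ℂ) := by
    simp only [sum_apply, smul_apply]
    rw [sum_inner]
    push_cast
    refine Finset.sum_congr rfl fun i _ => ?_
    rw [inner_sum, Finset.sum_eq_single i (fun j _ hj => horth i j hj.symm) (by simp),
      inner_self_eq_norm_sq_to_K, norm_smul]
    push_cast
    simp [mul_pow]
  rw [inner_self_eq_norm_sq_to_K] at h1
  exact Complex.ofReal_injective (by simpa using h1)

/-- By Pythagoras over the orthogonal ranges of the `p i`; the bound does not depend on the number
of projections. -/
theorem norm_sum_smul_le (h : IsSpectralDecomposition η μ p) {a : Fin n → ℂ} {C : ℝ} (hC : 0 ≤ C)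
    (ha : ∀ i, ‖a i‖ ≤ C) : ‖∑ i, a i • p i‖ ≤ C := by
  refine ContinuousLinearMap.opNorm_le_bound _ hC fun x => ?_
  refine le_of_sq_le_sq ?_ (by positivity)
  have h1 := h.norm_sq_sum_smul_apply (fun _ => 1) x
  simp only [one_smul, h.sum_eq_one, norm_one, one_pow, one_mul, one_apply_eq_self] at h1
  rw [h.norm_sq_sum_smul_apply, mul_pow, h1, Finset.mul_sum]
  gcongr with i
  exact ha i

theorem mem_spectrum [FiniteDimensional ℂ H] (h : IsSpectralDecomposition η μ p) (i : Fin n) :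
    μ i ∈ spectrum ℝ η := by
  rw [mem_spectrum_real_iff_hasEigenvalue]
  obtain ⟨v, hv⟩ : ∃ v, p i v ≠ 0 := by
    by_contra! h0
    exact h.ne_zero i (ContinuousLinearMap.ext h0)
  have hη : η * p i = (μ i : ℂ) • p i := by
    -- The coefficients `Pi.single i 1` present `p i` itself as a combination of the projections.
    have := h.sum_smul_mul_sum_smul (fun j => (μ j : ℂ)) (Pi.single i 1)
    rw [← h.eq_sum] at this
    simpa [Pi.single_apply] using this
  refine Module.End.hasEigenvalue_of_hasEigenvector (x := p i v) ⟨?_, hv⟩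
  rw [Module.End.mem_eigenspace_iff]
  exact DFunLike.congr_fun hη v

end IsSpectralDecomposition

end Decomposition

/-! ### Algebraic resolvent expansion -/

section Expansion

variable {A : Type*} [Ring A] [Algebra ℂ A]

/-- The second resolvent identity. Each substitution for `V` raises the order in `D` by one. -/
theorem left_inverse_eq_sub {η D B V : A} {t : ℂ} (hB : (1 + t • (η - 1)) * B = 1)
    (hV : V * (1 + t • (η + D - 1)) = 1) : V = B - t • (V * D * B) := by
  have h : 1 + t • (η + D - 1) = (1 + t • (η - 1)) + t • D := by module
  calc V = V * ((1 + t • (η - 1)) * B) := by rw [hB, mul_one]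
    _ = V * (1 + t • (η + D - 1)) * B - t • (V * D * B) := by
      rw [h]
      simp only [mul_add, add_mul, mul_smul_comm, smul_mul_assoc, mul_assoc]
      abel
    _ = B - t • (V * D * B) := by rw [hV, one_mul]

/-- Second order expansion, with remainder, of the integrand of the logarithm. -/
theorem left_inverse_mul_eq {η D B V : A} {t : ℂ} (hB' : B * (1 + t • (η - 1)) = 1)
    (hB : (1 + t • (η - 1)) * B = 1) (hV : V * (1 + t • (η + D - 1)) = 1) :
    V * (η + D - 1) = B * (η - 1) + B * D * B - t • (B * D * B * D * B) +
      t ^ 2 • (V * D * B * D * B * D * B) := by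
  have hVB := left_inverse_eq_sub hB hV
  -- This relation merges the two first-order terms `V D` and `-V D (t B (η - 1))` into `V D B`.
  have h1 : t • (B * (η - 1)) = 1 - B := by
    rw [mul_add, mul_one, mul_smul_comm] at hB'
    exact eq_sub_of_add_eq' hB'
  have h2 : V * (η + D - 1) = B * (η - 1) + V * D * B := by
    calc V * (η + D - 1) = V * (η - 1) + V * D := by rw [← mul_add]; congr 1; abel
      _ = (B - t • (V * D * B)) * (η - 1) + V * D := by rw [← hVB]
      _ = B * (η - 1) - V * D * (t • (B * (η - 1))) + V * D := by
        simp only [sub_mul, smul_mul_assoc, mul_smul_comm, mul_assoc]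
      _ = _ := by rw [h1, mul_sub (V * D), mul_one]; abel
  have h3 : V * D * B = B * D * B - t • (V * D * B * D * B) := by
    conv_lhs => rw [hVB]
    simp only [sub_mul, smul_mul_assoc, mul_assoc]
  have h4 : V * D * B * D * B = B * D * B * D * B - t • (V * D * B * D * B * D * B) := by
    conv_lhs => rw [h3]
    simp only [sub_mul, smul_mul_assoc, mul_assoc]
  calc V * (η + D - 1) = B * (η - 1) + (B * D * B -
        t • (B * D * B * D * B - t • (V * D * B * D * B * D * B))) := by rw [h2, ← h4, ← h3]
    _ = _ := by module

end Expansion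

/-! ### Integrated first- and second-order terms -/

section Perturbation

open Set

variable {H : Type*} [NormedAddCommGroup H] [InnerProductSpace ℂ H]
  {η : H →L[ℂ] H} {n : ℕ} {μ : Fin n → ℝ} {p : Fin n → H →L[ℂ] H}

/-- The inverse of `1 - t + t η`, in terms of the spectral data of `η`. -/
def kernelOp (μ : Fin n → ℝ) (p : Fin n → H →L[ℂ] H) (t : ℝ) : H →L[ℂ] H :=
  ∑ i, (kernel (μ i) t : ℂ) • p i

/-- The symmetric form `∫ Tr (X (1 - t + t η)⁻¹ Y (1 - t + t η)⁻¹) dt`. -/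
def kernelForm (μ : Fin n → ℝ) (p : Fin n → H →L[ℂ] H) (X Y : H →L[ℂ] H) : ℂ :=
  ∑ i, ∑ j, ((∫ t in (0 : ℝ)..1, kernel (μ i) t * kernel (μ j) t : ℝ) : ℂ) *
    tr (X * p i * Y * p j)

theorem continuousOn_kernelOp (p : Fin n → H →L[ℂ] H) (hμ : ∀ i, 0 < μ i) :
    ContinuousOn (kernelOp μ p) (uIcc 0 1) :=
  continuousOn_finsetSum _ fun i _ =>
    (Complex.continuous_ofReal.comp_continuousOn (continuousOn_kernel (hμ i))).smul
      continuousOn_const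

theorem integral_ofReal_mul_const (f : ℝ → ℝ) (z : ℂ) :
    ∫ t in (0 : ℝ)..1, (f t : ℂ) * z = ((∫ t in (0 : ℝ)..1, f t : ℝ) : ℂ) * z := by
  rw [intervalIntegral.integral_mul_const, intervalIntegral.integral_ofReal]

theorem intervalIntegrable_ofReal_mul_const {f : ℝ → ℝ} (hf : ContinuousOn f (uIcc 0 1)) (z : ℂ) :
    IntervalIntegrable (fun t => (f t : ℂ) * z) MeasureTheory.volume 0 1 :=
  ((Complex.continuous_ofReal.comp_continuousOn hf).mul continuousOn_const).intervalIntegrable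

theorem integral_sum_sum_ofReal_mul {f : Fin n → Fin n → ℝ → ℝ}
    (hf : ∀ i j, ContinuousOn (f i j) (uIcc 0 1)) (z : Fin n → Fin n → ℂ) :
    ∫ t in (0 : ℝ)..1, ∑ i, ∑ j, (f i j t : ℂ) * z i j =
      ∑ i, ∑ j, ((∫ t in (0 : ℝ)..1, f i j t : ℝ) : ℂ) * z i j := by
  have hint := fun i j => intervalIntegrable_ofReal_mul_const (hf i j) (z i j)
  rw [intervalIntegral.integral_finsetSum fun i _ => by
    simpa only [Finset.sum_fn] using IntervalIntegrable.sum Finset.univ fun j _ => hint i j]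
  refine Finset.sum_congr rfl fun i _ => ?_
  rw [intervalIntegral.integral_finsetSum fun j _ => hint i j]
  exact Finset.sum_congr rfl fun j _ => integral_ofReal_mul_const _ _

theorem tr_sum_smul_mul_sum_smul [FiniteDimensional ℂ H] (X Y : H →L[ℂ] H) (a b : Fin n → ℂ) :
    tr (X * (∑ i, a i • p i) * Y * ∑ j, b j • p j) =
      ∑ i, ∑ j, (a i * b j) * tr (X * p i * Y * p j) := by
  simp only [Finset.mul_sum, Finset.sum_mul, tr_sum, mul_smul_comm, smul_mul_assoc, tr_smul]
  rw [Finset.sum_comm]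
  refine Finset.sum_congr rfl fun i _ => Finset.sum_congr rfl fun j _ => by ring

theorem integral_tr_kernelOp [FiniteDimensional ℂ H] (p : Fin n → H →L[ℂ] H) (hμ : ∀ i, 0 < μ i)
    (X Y : H →L[ℂ] H) :
    ∫ t in (0 : ℝ)..1, tr (X * kernelOp μ p t * Y * kernelOp μ p t) = kernelForm μ p X Y := by
  simp only [kernelOp, tr_sum_smul_mul_sum_smul, ← Complex.ofReal_mul]
  exact integral_sum_sum_ofReal_mul
    (fun i j => (continuousOn_kernel (hμ i)).mul (continuousOn_kernel (hμ j))) _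

theorem kernelForm_comm (X Y : H →L[ℂ] H) : kernelForm μ p X Y = kernelForm μ p Y X := by
  rw [kernelForm, Finset.sum_comm, kernelForm]
  refine Finset.sum_congr rfl fun i _ => Finset.sum_congr rfl fun j _ => ?_
  congr 1
  · simp only [mul_comm]
  · rw [mul_assoc, tr_mul_comm, ← mul_assoc]

theorem kernelForm_sub_right [FiniteDimensional ℂ H] (X Y Z : H →L[ℂ] H) :
    kernelForm μ p X (Y - Z) = kernelForm μ p X Y - kernelForm μ p X Z := by
  simp only [kernelForm, mul_sub, sub_mul, tr_sub, Finset.sum_sub_distrib]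

variable [CompleteSpace H]

namespace IsSpectralDecomposition

theorem one_add_smul_eq (h : IsSpectralDecomposition η μ p) (t : ℝ) :
    1 + (t : ℂ) • (η - 1) = ∑ i, ((1 + t * (μ i - 1) : ℝ) : ℂ) • p i := by
  rw [h.eq_sum, ← h.sum_eq_one, ← Finset.sum_sub_distrib, Finset.smul_sum,
    ← Finset.sum_add_distrib]
  refine Finset.sum_congr rfl fun i _ => ?_
  push_cast
  module

theorem kernelOp_mul (h : IsSpectralDecomposition η μ p) (hμ : ∀ i, 0 < μ i) {t : ℝ}
    (ht : t ∈ Icc (0 : ℝ) 1) : kernelOp μ p t * (1 + (t : ℂ) • (η - 1)) = 1 := by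
  rw [kernelOp, h.one_add_smul_eq, h.sum_smul_mul_sum_smul, ← h.sum_eq_one]
  refine Finset.sum_congr rfl fun i _ => ?_
  rw [kernel, ← Complex.ofReal_mul, inv_mul_cancel₀ (one_add_mul_sub_one_pos (hμ i) ht).ne']
  simp

theorem mul_kernelOp (h : IsSpectralDecomposition η μ p) (hμ : ∀ i, 0 < μ i) {t : ℝ}
    (ht : t ∈ Icc (0 : ℝ) 1) : (1 + (t : ℂ) • (η - 1)) * kernelOp μ p t = 1 := by
  rw [kernelOp, h.one_add_smul_eq, h.sum_smul_mul_sum_smul, ← h.sum_eq_one]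
  refine Finset.sum_congr rfl fun i _ => ?_
  rw [kernel, ← Complex.ofReal_mul, mul_inv_cancel₀ (one_add_mul_sub_one_pos (hμ i) ht).ne']
  simp

theorem norm_kernelOp_le (h : IsSpectralDecomposition η μ p) {m : ℝ} (hm : 0 < m) (hm1 : m ≤ 1)
    (hμ : ∀ i, m ≤ μ i) {t : ℝ} (ht : t ∈ Icc (0 : ℝ) 1) : ‖kernelOp μ p t‖ ≤ m⁻¹ := by
  refine h.norm_sum_smul_le (by positivity) fun i => ?_
  have h1 := le_one_add_mul_sub_one hm1 (hμ i) ht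
  have h2 : 0 < 1 + t * (μ i - 1) := hm.trans_le h1
  rw [Complex.norm_real, kernel, Real.norm_of_nonneg (by positivity)]
  exact inv_anti₀ hm h1

theorem kernelOp_mul_mul_kernelOp (h : IsSpectralDecomposition η μ p) (t : ℝ) :
    kernelOp μ p t * η * kernelOp μ p t =
      ∑ i, ((μ i * (kernel (μ i) t * kernel (μ i) t) : ℝ) : ℂ) • p i := by
  conv_lhs => rw [h.eq_sum]
  rw [kernelOp, h.sum_smul_mul_sum_smul, h.sum_smul_mul_sum_smul]
  refine Finset.sum_congr rfl fun i _ => ?_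
  push_cast
  ring_nf

/-- Cyclicity of the trace makes the `(i, j)` and `(j, i)` terms equal, so the full double sum is
twice the sum over `i < j`; on the diagonal `1/μ = 2 · 1/(2μ)`. -/
theorem kernelForm_self (h : IsSpectralDecomposition η μ p) (hμ : ∀ i, 0 < μ i)
    (X : H →L[ℂ] H) : kernelForm μ p X X = 2 * quadF μ p X := by
  set g : Fin n → Fin n → ℂ := fun i j =>
    ((∫ t in (0 : ℝ)..1, kernel (μ i) t * kernel (μ j) t : ℝ) : ℂ) * tr (X * p i * X * p j) with hg
  have hsymm : ∀ i j, g i j = g j i := fun i j => by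
    simp only [hg]
    congr 1
    · simp only [mul_comm]
    · rw [mul_assoc, tr_mul_comm, ← mul_assoc]
  have h1 : kernelForm μ p X X = ∑ i, g i i + ∑ i, ∑ j ∈ Finset.Ioi i, 2 * g j i := by
    have := Finset.sum_sum_Ioi_add_eq_sum_sum_off_diag g
    rw [kernelForm, Finset.sum_comm]
    calc ∑ i, ∑ j, g j i = ∑ i, (g i i + ∑ j ∈ {i}ᶜ, g j i) :=
          Finset.sum_congr rfl fun i _ => Fintype.sum_eq_add_sum_compl i _
      _ = ∑ i, g i i + ∑ i, ∑ j ∈ Finset.Ioi i, (g j i + g i j) := by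
          rw [Finset.sum_add_distrib, this]
      _ = _ := by
          congr 1
          refine Finset.sum_congr rfl fun i _ => Finset.sum_congr rfl fun j _ => ?_
          rw [hsymm i j, two_mul]
  rw [h1, quadF, bilinF, mul_add, Finset.mul_sum, Finset.mul_sum]
  congr 1
  · refine Finset.sum_congr rfl fun i _ => ?_
    simp only [hg]
    rw [integral_kernel_sq (hμ i)]
    push_cast
    field_simp
  · refine Finset.sum_congr rfl fun i _ => ?_
    rw [Finset.mul_sum]
    refine Finset.sum_congr rfl fun j hj => ?_
    have hij : μ i ≠ μ j := fun he => (Finset.mem_Ioi.mp hj).ne (h.injective he)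
    rw [← integral_kernel_mul_kernel (hμ i) (hμ j) hij]
    simp only [hg, mul_comm]

variable [FiniteDimensional ℂ H]

/-- Cyclicity brings out `B η B`, whose `i`-th coefficient `μ k²` integrates to `1`. Hence traceless
perturbations contribute nothing at first order. -/
theorem integral_tr_mul_kernelOp (h : IsSpectralDecomposition η μ p) (hμ : ∀ i, 0 < μ i)
    (X : H →L[ℂ] H) :
    ∫ t in (0 : ℝ)..1, tr (η * (kernelOp μ p t * X * kernelOp μ p t)) = tr X := by
  have h1 : ∀ t, tr (η * (kernelOp μ p t * X * kernelOp μ p t)) =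
      ∑ i, ((μ i * (kernel (μ i) t * kernel (μ i) t) : ℝ) : ℂ) * tr (p i * X) := by
    intro t
    rw [← mul_assoc, tr_mul_comm, ← mul_assoc, ← mul_assoc, h.kernelOp_mul_mul_kernelOp,
      Finset.sum_mul, tr_sum]
    simp only [smul_mul_assoc, tr_smul]
  have hc : ∀ i, ContinuousOn (fun t => μ i * (kernel (μ i) t * kernel (μ i) t)) (uIcc 0 1) :=
    fun i => continuousOn_const.mul ((continuousOn_kernel (hμ i)).mul (continuousOn_kernel (hμ i)))
  simp only [h1]
  rw [intervalIntegral.integral_finsetSum fun i _ =>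
    intervalIntegrable_ofReal_mul_const (hc i) _]
  simp only [integral_ofReal_mul_const, intervalIntegral.integral_const_mul]
  have h2 : ∀ i, μ i * ∫ t in (0 : ℝ)..1, kernel (μ i) t * kernel (μ i) t = 1 := fun i => by
    rw [integral_kernel_sq (hμ i), mul_one_div, div_self (hμ i).ne']
  simp only [h2, Complex.ofReal_one, one_mul]
  rw [← tr_sum, ← Finset.sum_mul, h.sum_eq_one, one_mul]

/-- After cyclic reordering, the coefficient `t μᵢ kᵢ² kⱼ` is not symmetric in `i, j` but the trace
it multiplies is. Adding the sum with indices exchanged permits `integral_mul_kernel_add_swap`. -/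
theorem integral_tr_second_order (h : IsSpectralDecomposition η μ p) (hμ : ∀ i, 0 < μ i)
    (X : H →L[ℂ] H) :
    2 * ∫ t in (0 : ℝ)..1, (t : ℂ) *
      tr (η * (kernelOp μ p t * X * kernelOp μ p t * X * kernelOp μ p t)) =
      kernelForm μ p X X := by
  have h1 : ∀ t : ℝ, (t : ℂ) *
      tr (η * (kernelOp μ p t * X * kernelOp μ p t * X * kernelOp μ p t)) =
      ∑ i, ∑ j, ((t * (μ i * (kernel (μ i) t * kernel (μ i) t)) * kernel (μ j) t : ℝ) : ℂ) *
        tr (X * p i * X * p j) := by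
    intro t
    have : tr (η * (kernelOp μ p t * X * kernelOp μ p t * X * kernelOp μ p t)) =
        tr (X * (kernelOp μ p t * η * kernelOp μ p t) * X * kernelOp μ p t) := by
      rw [← mul_assoc, tr_mul_comm]
      simp only [mul_assoc]
      rw [tr_mul_comm X]
      simp only [mul_assoc]
    rw [this, h.kernelOp_mul_mul_kernelOp, kernelOp, tr_sum_smul_mul_sum_smul, Finset.mul_sum]
    refine Finset.sum_congr rfl fun i _ => ?_
    rw [Finset.mul_sum]
    refine Finset.sum_congr rfl fun j _ => ?_
    push_cast
    ring
  simp only [h1]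
  rw [integral_sum_sum_ofReal_mul fun i j => continuousOn_mul_kernel (hμ i) (hμ j), two_mul]
  nth_rewrite 2 [Finset.sum_comm]
  rw [← Finset.sum_add_distrib, kernelForm]
  refine Finset.sum_congr rfl fun i _ => ?_
  rw [← Finset.sum_add_distrib]
  refine Finset.sum_congr rfl fun j _ => ?_
  have h2 : tr (X * p j * X * p i) = tr (X * p i * X * p j) := by
    rw [mul_assoc, tr_mul_comm, ← mul_assoc]
  rw [h2, ← add_mul, ← Complex.ofReal_add, integral_mul_kernel_add_swap (hμ i) (hμ j)]

end IsSpectralDecomposition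

end Perturbation

/-! ### Entropy integral and remainder estimates -/

section Entropy

open Set

variable {H : Type*} [NormedAddCommGroup H] [InnerProductSpace ℂ H]

theorem HasLog.spectrum_subset {M : H →L[ℂ] H} (h : HasLog M) :
    spectrum ℂ M ⊆ Complex.slitPlane := by
  obtain ⟨γ, -, h1, h2⟩ := h
  exact (h2.trans Metric.ball_subset_closedBall).trans h1

variable [CompleteSpace H]

/-- The right side involves no contour, so the arbitrary choice of circle in `opLog` becomes
irrelevant. -/
theorem opLog_eq_integral {M : H →L[ℂ] H} (h : HasLog M) :
    opLog M = ∫ t in (0 : ℝ)..1, Ring.inverse (1 + (t : ℂ) • (M - 1)) * (M - 1) := by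
  obtain ⟨h0, h1, h2⟩ := h.choose_spec
  rw [opLog, dif_pos h, circleIntegral_log_smul_resolvent M h0 h1 h2, smul_smul,
    inv_mul_cancel₀ Complex.two_pi_I_ne_zero, one_smul]

theorem hasLog_of_norm_sub_one_lt {M : H →L[ℂ] H} (h : ‖M - 1‖ < 1) : HasLog M := by
  -- The radius is midway between `‖M - 1‖`, which bounds the spectrum of `M - 1`, and `1`, the
  -- distance from the centre to the cut.
  refine ⟨(1, (1 + ‖M - 1‖) / 2), by positivity, fun z hz => ?_, fun z hz => ?_⟩
  · rw [mem_closedBall_iff_norm] at hz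
    have : ‖z - 1‖ < 1 := by dsimp only at hz; linarith
    simpa using Complex.mem_slitPlane_of_norm_lt_one this
  · have hz' : z - 1 ∈ spectrum ℂ (M - 1) := by
      rw [spectrum.mem_iff] at hz ⊢
      simpa using hz
    have h1 := spectrum.norm_le_norm_mul_of_mem hz'
    have h2 : ‖(1 : H →L[ℂ] H)‖ ≤ 1 := ContinuousLinearMap.norm_id_le
    rw [mem_ball_iff_norm]
    have := mul_le_mul_of_nonneg_left h2 (norm_nonneg (M - 1))
    dsimp only
    linarith

theorem continuousOn_log_integrand {M : H →L[ℂ] H} (h : HasLog M) :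
    ContinuousOn (fun t : ℝ => Ring.inverse (1 + (t : ℂ) • (M - 1)) * (M - 1)) (uIcc 0 1) := by
  rw [uIcc_of_le zero_le_one]
  exact (continuousOn_inverse_one_add_smul_sub_one h.spectrum_subset).mul continuousOn_const

theorem relEntropy_eq_integral [FiniteDimensional ℂ H] {ρ ν : H →L[ℂ] H} (hρ : HasLog ρ)
    (hν : HasLog ν) :
    relEntropy ρ ν = ∫ t in (0 : ℝ)..1, tr (ρ *
      (Ring.inverse (1 + (t : ℂ) • (ρ - 1)) * (ρ - 1) -
        Ring.inverse (1 + (t : ℂ) • (ν - 1)) * (ν - 1))) := by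
  have h1 := (continuousOn_log_integrand hρ).intervalIntegrable (μ := MeasureTheory.volume)
  have h2 := (continuousOn_log_integrand hν).intervalIntegrable (μ := MeasureTheory.volume)
  rw [relEntropy, opLog_eq_integral hρ, opLog_eq_integral hν,
    ← intervalIntegral.integral_sub h1 h2]
  exact (((trCLM H).comp (ContinuousLinearMap.mul ℂ (H →L[ℂ] H) ρ)).intervalIntegral_comp_comm
    (h1.sub h2)).symm

/-- In `V = B - t V D B` the last term has norm at most `‖V‖/2`, which is absorbed on the left. -/
theorem norm_left_inverse_le {A : Type*} [NormedRing A] [NormedAlgebra ℂ A] {η D B V : A}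
    {t m : ℝ} (hm : 0 < m) (ht : t ∈ Icc (0 : ℝ) 1) (hD : ‖D‖ ≤ m / 2) (hBn : ‖B‖ ≤ m⁻¹)
    (hB : (1 + (t : ℂ) • (η - 1)) * B = 1) (hV : V * (1 + (t : ℂ) • (η + D - 1)) = 1) :
    ‖V‖ ≤ 2 * m⁻¹ := by
  have h1 : ‖V‖ ≤ ‖B‖ + ‖(t : ℂ) • (V * D * B)‖ := by
    conv_lhs => rw [left_inverse_eq_sub hB hV]
    exact norm_sub_le _ _
  have h2 : ‖(t : ℂ) • (V * D * B)‖ ≤ 1 * (‖V‖ * (m / 2) * m⁻¹) := by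
    rw [norm_smul, Complex.norm_real, Real.norm_of_nonneg ht.1]
    refine mul_le_mul ht.2 ((norm_mul_le _ _).trans ?_) (norm_nonneg _) zero_le_one
    refine mul_le_mul ((norm_mul_le _ _).trans ?_) hBn (norm_nonneg _) (by positivity)
    gcongr
  have h3 : 1 * (‖V‖ * (m / 2) * m⁻¹) = ‖V‖ / 2 := by field_simp
  linarith

theorem norm_second_order_le {A : Type*} [NormedRing A] [NormedAlgebra ℂ A] {D B : A} {t b : ℝ}
    (ht : t ∈ Icc (0 : ℝ) 1) (hB : ‖B‖ ≤ b) :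
    ‖(t : ℂ) • (B * D * B * D * B)‖ ≤ b ^ 3 * ‖D‖ ^ 2 := by
  have hb : 0 ≤ b := (norm_nonneg B).trans hB
  rw [norm_smul, Complex.norm_real, Real.norm_of_nonneg ht.1]
  calc t * ‖B * D * B * D * B‖ ≤ 1 * (‖B‖ * ‖D‖ * ‖B‖ * ‖D‖ * ‖B‖) := by
        refine mul_le_mul ht.2 ?_ (norm_nonneg _) zero_le_one
        iterate 3 refine (norm_mul_le _ _).trans (mul_le_mul_of_nonneg_right ?_ (norm_nonneg _))
        exact norm_mul_le _ _
    _ ≤ 1 * (b * ‖D‖ * b * ‖D‖ * b) := by gcongr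
    _ = _ := by ring

theorem norm_third_order_le {A : Type*} [NormedRing A] [NormedAlgebra ℂ A] {D B V : A} {t b : ℝ}
    (ht : t ∈ Icc (0 : ℝ) 1) (hB : ‖B‖ ≤ b) (hV : ‖V‖ ≤ 2 * b) :
    ‖(t : ℂ) ^ 2 • (V * D * B * D * B * D * B)‖ ≤ 2 * b ^ 4 * ‖D‖ ^ 3 := by
  have hb : 0 ≤ b := (norm_nonneg B).trans hB
  rw [norm_smul, norm_pow, Complex.norm_real, Real.norm_of_nonneg ht.1]
  calc t ^ 2 * ‖V * D * B * D * B * D * B‖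
      ≤ 1 * (‖V‖ * ‖D‖ * ‖B‖ * ‖D‖ * ‖B‖ * ‖D‖ * ‖B‖) := by
        refine mul_le_mul (pow_le_one₀ ht.1 ht.2) ?_ (norm_nonneg _) zero_le_one
        iterate 5 refine (norm_mul_le _ _).trans (mul_le_mul_of_nonneg_right ?_ (norm_nonneg _))
        exact norm_mul_le _ _
    _ ≤ 1 * (2 * b * ‖D‖ * b * ‖D‖ * b * ‖D‖ * b) := by gcongr
    _ = _ := by ring

variable {η : H →L[ℂ] H} {n : ℕ} {μ : Fin n → ℝ} {p : Fin n → H →L[ℂ] H}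

/-- Eigenvalues in `[m, 1]` give `‖η - 1‖ ≤ 1 - m`; the perturbation uses half of the gap `m`. -/
theorem IsSpectralDecomposition.hasLog_add (h : IsSpectralDecomposition η μ p) {m : ℝ}
    (hm : 0 < m) (hm1 : m ≤ 1)
    (hμ : ∀ i, m ≤ μ i) (hμ1 : ∀ i, μ i ≤ 1) {D : H →L[ℂ] H} (hD : ‖D‖ ≤ m / 2) :
    HasLog (η + D) := by
  refine hasLog_of_norm_sub_one_lt ?_
  have h1 : ‖η - 1‖ ≤ 1 - m := by
    have : η - 1 = ∑ i, ((μ i - 1 : ℝ) : ℂ) • p i := by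
      rw [← h.sum_eq_one, h.eq_sum, ← Finset.sum_sub_distrib]
      refine Finset.sum_congr rfl fun i _ => ?_
      push_cast
      module
    rw [this]
    refine h.norm_sum_smul_le (by linarith) fun i => ?_
    rw [Complex.norm_real, Real.norm_eq_abs, abs_le]
    constructor <;> linarith [hμ i, hμ1 i]
  calc ‖η + D - 1‖ = ‖(η - 1) + D‖ := by congr 1; abel
    _ ≤ _ := norm_add_le _ _
    _ < 1 := by linarith

variable [FiniteDimensional ℂ H]

/-- The terms of order at most two in the integrand of `S(η + D₁|η + D₂)`. -/
def secondOrder (η : H →L[ℂ] H) (B : H →L[ℂ] H) (t : ℝ) (D₁ D₂ : H →L[ℂ] H) : ℂ :=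
  tr (η * (B * (D₁ - D₂) * B)) + tr (D₁ * B * (D₁ - D₂) * B) -
    t * tr (η * (B * D₁ * B * D₁ * B)) + t * tr (η * (B * D₂ * B * D₂ * B))

theorem continuousOn_tr {H : Type*} [NormedAddCommGroup H] [InnerProductSpace ℂ H]
    [FiniteDimensional ℂ H] {f : ℝ → H →L[ℂ] H} {s : Set ℝ} (hf : ContinuousOn f s) :
    ContinuousOn (fun t => tr (f t)) s :=
  (trCLM H).continuous.comp_continuousOn hf

theorem continuousOn_secondOrder {B : ℝ → H →L[ℂ] H} {s : Set ℝ} (hB : ContinuousOn B s)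
    (D₁ D₂ : H →L[ℂ] H) : ContinuousOn (fun t => secondOrder η (B t) t D₁ D₂) s := by
  have hc : ∀ X : H →L[ℂ] H, ContinuousOn (fun _ : ℝ => X) s := fun X => continuousOn_const
  have ht : ContinuousOn (fun t : ℝ => (t : ℂ)) s := Complex.continuous_ofReal.continuousOn
  exact (((continuousOn_tr ((hc η).mul ((hB.mul (hc _)).mul hB))).add
    (continuousOn_tr ((((hc D₁).mul hB).mul (hc _)).mul hB))).sub (ht.mul (continuousOn_tr
      ((hc η).mul ((((hB.mul (hc D₁)).mul hB).mul (hc D₁)).mul hB))))).add (ht.mul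
        (continuousOn_tr ((hc η).mul ((((hB.mul (hc D₂)).mul hB).mul (hc D₂)).mul hB))))

namespace IsSpectralDecomposition

theorem integral_secondOrder (h : IsSpectralDecomposition η μ p) (hμ : ∀ i, 0 < μ i)
    {D₁ D₂ : H →L[ℂ] H} (h₁ : tr D₁ = 0) (h₂ : tr D₂ = 0) :
    ∫ t in (0 : ℝ)..1, secondOrder η (kernelOp μ p t) t D₁ D₂ = quadF μ p (D₁ - D₂) := by
  have hB := continuousOn_kernelOp p hμ
  have hc : ∀ X : H →L[ℂ] H, ContinuousOn (fun _ : ℝ => X) (uIcc 0 1) :=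
    fun X => continuousOn_const
  have ht : ContinuousOn (fun t : ℝ => (t : ℂ)) (uIcc 0 1) :=
    Complex.continuous_ofReal.continuousOn
  have i1 : IntervalIntegrable (fun t => tr (η * (kernelOp μ p t * (D₁ - D₂) * kernelOp μ p t)))
      MeasureTheory.volume 0 1 :=
    (continuousOn_tr ((hc η).mul ((hB.mul (hc _)).mul hB))).intervalIntegrable
  have i2 : IntervalIntegrable (fun t => tr (D₁ * kernelOp μ p t * (D₁ - D₂) * kernelOp μ p t))
      MeasureTheory.volume 0 1 :=
    (continuousOn_tr ((((hc D₁).mul hB).mul (hc _)).mul hB)).intervalIntegrable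
  have i3 : ∀ D : H →L[ℂ] H, IntervalIntegrable (fun t : ℝ => (t : ℂ) *
      tr (η * (kernelOp μ p t * D * kernelOp μ p t * D * kernelOp μ p t)))
      MeasureTheory.volume 0 1 := fun D =>
    (ht.mul (continuousOn_tr
      ((hc η).mul ((((hB.mul (hc D)).mul hB).mul (hc D)).mul hB)))).intervalIntegrable
  simp only [secondOrder]
  rw [intervalIntegral.integral_add ((i1.add i2).sub (i3 D₁)) (i3 D₂),
    intervalIntegral.integral_sub (i1.add i2) (i3 D₁), intervalIntegral.integral_add i1 i2,
    h.integral_tr_mul_kernelOp hμ, integral_tr_kernelOp p hμ, tr_sub, h₁, h₂]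
  have e1 := h.integral_tr_second_order hμ D₁
  have e2 := h.integral_tr_second_order hμ D₂
  have e3 := h.kernelForm_self hμ (D₁ - D₂)
  rw [kernelForm_sub_right, kernelForm_comm _ D₁, kernelForm_comm _ D₂, kernelForm_sub_right,
    kernelForm_sub_right, kernelForm_comm D₂ D₁] at e3
  rw [kernelForm_sub_right]
  -- Polarisation: `K(D₁, D₁ - D₂) - K(D₁, D₁)/2 + K(D₂, D₂)/2 = K(D₁ - D₂, D₁ - D₂)/2`.
  linear_combination (1 / 2 : ℂ) * e3 - (1 / 2 : ℂ) * e1 + (1 / 2 : ℂ) * e2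

theorem norm_tr_sub_secondOrder_le (h : IsSpectralDecomposition η μ p) {m : ℝ} (hm : 0 < m)
    (hm1 : m ≤ 1) (hμ : ∀ i, m ≤ μ i) (hμ1 : ∀ i, μ i ≤ 1) {D₁ D₂ : H →L[ℂ] H}
    (hD₁ : ‖D₁‖ ≤ m / 2) (hD₂ : ‖D₂‖ ≤ m / 2) (hL₁ : HasLog (η + D₁)) (hL₂ : HasLog (η + D₂))
    {t : ℝ} (ht : t ∈ Icc (0 : ℝ) 1) :
    ‖tr ((η + D₁) * (Ring.inverse (1 + (t : ℂ) • (η + D₁ - 1)) * (η + D₁ - 1) -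
        Ring.inverse (1 + (t : ℂ) • (η + D₂ - 1)) * (η + D₂ - 1))) -
      secondOrder η (kernelOp μ p t) t D₁ D₂‖ ≤
      Module.finrank ℂ H * (5 * m⁻¹ ^ 4 * (‖D₁‖ + ‖D₂‖) ^ 3) := by
  have hμ0 : ∀ i, 0 < μ i := fun i => hm.trans_le (hμ i)
  have hBn := h.norm_kernelOp_le hm hm1 hμ ht
  have hB' := h.kernelOp_mul hμ0 ht
  have hB := h.mul_kernelOp hμ0 ht
  set B := kernelOp μ p t
  have hV₁ := Ring.inverse_mul_cancel _ (isUnit_one_add_smul_sub_one hL₁.spectrum_subset ht)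
  have hV₂ := Ring.inverse_mul_cancel _ (isUnit_one_add_smul_sub_one hL₂.spectrum_subset ht)
  set V₁ := Ring.inverse (1 + (t : ℂ) • (η + D₁ - 1))
  set V₂ := Ring.inverse (1 + (t : ℂ) • (η + D₂ - 1))
  have hη : ‖η‖ ≤ 1 := by
    rw [h.eq_sum]
    refine h.norm_sum_smul_le zero_le_one fun i => ?_
    rw [Complex.norm_real, Real.norm_of_nonneg (hμ0 i).le]
    exact hμ1 i
  have hS₁ := norm_second_order_le (D := D₁) ht hBn
  have hS₂ := norm_second_order_le (D := D₂) ht hBn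
  have hR₁ := norm_third_order_le (D := D₁) ht hBn (norm_left_inverse_le hm ht hD₁ hBn hB hV₁)
  have hR₂ := norm_third_order_le (D := D₂) ht hBn (norm_left_inverse_le hm ht hD₂ hBn hB hV₂)
  -- Everything left is cubic: `D₁` against the quadratic terms of both logarithms, and `η + D₁`
  -- against their exact remainders.
  have key : tr ((η + D₁) * (V₁ * (η + D₁ - 1) - V₂ * (η + D₂ - 1))) - secondOrder η B t D₁ D₂ =
      tr (D₁ * ((t : ℂ) • (B * D₂ * B * D₂ * B) - (t : ℂ) • (B * D₁ * B * D₁ * B)) +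
        (η + D₁) * ((t : ℂ) ^ 2 • (V₁ * D₁ * B * D₁ * B * D₁ * B) -
          (t : ℂ) ^ 2 • (V₂ * D₂ * B * D₂ * B * D₂ * B))) := by
    rw [left_inverse_mul_eq hB' hB hV₁, left_inverse_mul_eq hB' hB hV₂, secondOrder]
    simp only [← tr_smul, ← tr_sub, ← tr_add]
    congr 1
    simp only [mul_add, mul_sub, add_mul, sub_mul, mul_smul_comm, smul_add, mul_assoc]
    abel
  rw [key]
  refine (norm_tr_le _).trans (mul_le_mul_of_nonneg_left ?_ (Nat.cast_nonneg _))
  set b := m⁻¹ with hb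
  have hb1 : 1 ≤ b := (one_le_inv₀ hm).mpr hm1
  have hηD : ‖η + D₁‖ ≤ 2 := (norm_add_le _ _).trans (by linarith)
  set d₁ := ‖D₁‖
  set d₂ := ‖D₂‖
  have hd₁ : 0 ≤ d₁ := norm_nonneg _
  have hd₂ : 0 ≤ d₂ := norm_nonneg _
  calc _ ≤ d₁ * (b ^ 3 * d₂ ^ 2 + b ^ 3 * d₁ ^ 2) +
        2 * (2 * b ^ 4 * d₁ ^ 3 + 2 * b ^ 4 * d₂ ^ 3) := by
        refine (norm_add_le _ _).trans (add_le_add ?_ ?_)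
        · exact (norm_mul_le _ _).trans (mul_le_mul_of_nonneg_left
            ((norm_sub_le _ _).trans (add_le_add hS₂ hS₁)) hd₁)
        · exact (norm_mul_le _ _).trans (mul_le_mul hηD
            ((norm_sub_le _ _).trans (add_le_add hR₁ hR₂)) (norm_nonneg _) zero_le_two)
    _ ≤ d₁ * (b ^ 4 * d₂ ^ 2 + b ^ 4 * d₁ ^ 2) +
        2 * (2 * b ^ 4 * d₁ ^ 3 + 2 * b ^ 4 * d₂ ^ 3) := by
        -- As `b = 1/m ≥ 1`, all terms take the common factor `b⁴`. The `d₁³` coefficient `1 + 2 · 2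
        -- = 5` then dictates the constant.
        have : b ^ 3 ≤ b ^ 4 := pow_le_pow_right₀ hb1 (by norm_num)
        gcongr
    _ = b ^ 4 * (5 * d₁ ^ 3 + 4 * d₂ ^ 3 + d₁ * d₂ ^ 2) := by ring
    _ ≤ b ^ 4 * (5 * (d₁ + d₂) ^ 3) := by
        gcongr
        have h3 : 0 ≤ d₁ ^ 2 * d₂ := by positivity
        have h4 : 0 ≤ d₁ * d₂ ^ 2 := by positivity
        have h5 : 0 ≤ d₂ ^ 3 := by positivity
        linarith [show (d₁ + d₂) ^ 3 = d₁ ^ 3 + 3 * (d₁ ^ 2 * d₂) + 3 * (d₁ * d₂ ^ 2) + d₂ ^ 3 by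
          ring]
    _ = _ := by ring

theorem norm_relEntropy_sub_quadF_le (h : IsSpectralDecomposition η μ p) {m : ℝ} (hm : 0 < m)
    (hm1 : m ≤ 1) (hμ : ∀ i, m ≤ μ i) (hμ1 : ∀ i, μ i ≤ 1) {D₁ D₂ : H →L[ℂ] H}
    (h₁ : tr D₁ = 0) (h₂ : tr D₂ = 0) (hD₁ : ‖D₁‖ ≤ m / 2) (hD₂ : ‖D₂‖ ≤ m / 2) :
    ‖relEntropy (η + D₁) (η + D₂) - quadF μ p (D₁ - D₂)‖ ≤
      Module.finrank ℂ H * (5 * m⁻¹ ^ 4 * (‖D₁‖ + ‖D₂‖) ^ 3) := by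
  have hμ0 : ∀ i, 0 < μ i := fun i => hm.trans_le (hμ i)
  have hL₁ := h.hasLog_add hm hm1 hμ hμ1 hD₁
  have hL₂ := h.hasLog_add hm hm1 hμ hμ1 hD₂
  have hint : IntervalIntegrable (fun t : ℝ => tr ((η + D₁) *
      (Ring.inverse (1 + (t : ℂ) • (η + D₁ - 1)) * (η + D₁ - 1) -
        Ring.inverse (1 + (t : ℂ) • (η + D₂ - 1)) * (η + D₂ - 1)))) MeasureTheory.volume 0 1 :=
    (continuousOn_tr (continuousOn_const.mul ((continuousOn_log_integrand hL₁).sub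
      (continuousOn_log_integrand hL₂)))).intervalIntegrable
  rw [relEntropy_eq_integral hL₁ hL₂, ← h.integral_secondOrder hμ0 h₁ h₂,
    ← intervalIntegral.integral_sub hint
      (continuousOn_secondOrder (continuousOn_kernelOp p hμ0) D₁ D₂).intervalIntegrable]
  refine (intervalIntegral.norm_integral_le_of_norm_le_const fun t ht => ?_).trans_eq
    (by rw [sub_zero, abs_one, mul_one])
  rw [uIoc_of_le zero_le_one] at ht
  exact h.norm_tr_sub_secondOrder_le hm hm1 hμ hμ1 hD₁ hD₂ hL₁ hL₂ (Ioc_subset_Icc_self ht)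

end IsSpectralDecomposition

theorem finrank_mul_le_constC (h : IsFaithfulState η) {x : ℝ} (hx : 0 ≤ x) :
    Module.finrank ℂ H * (5 * (infSp η)⁻¹ ^ 4 * x) ≤ constC 10 η * x := by
  have hm := h.infSp_pos
  -- Here `log 2 > 1/2` and `log inf sp η ≤ 0`, so `c = 10` absorbs the factor `5`.
  have hlog : 5 ≤ 10 * (Real.log 2 - Real.log (infSp η)) := by
    linarith [Real.log_two_gt_d9, Real.log_nonpos hm.le h.infSp_le_one]
  calc Module.finrank ℂ H * (5 * (infSp η)⁻¹ ^ 4 * x)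
      = 5 * (Module.finrank ℂ H * (infSp η)⁻¹ ^ 4 * x) := by ring
    _ ≤ 10 * (Real.log 2 - Real.log (infSp η)) * (Module.finrank ℂ H * (infSp η)⁻¹ ^ 4 * x) := by
        gcongr
    _ = constC 10 η * x := by rw [constC, inv_pow, div_eq_mul_inv]; ring

end Entropy

end EntropyPerturbation

end

open EntropyPerturbation in
theorem proposition5p1 :
    ∃ c : ℝ, 0 < c ∧
      ∀ (H : Type*) [NormedAddCommGroup H] [InnerProductSpace ℂ H] [CompleteSpace H]
        [FiniteDimensional ℂ H] (η : H →L[ℂ] H), IsFaithfulState η →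
        0 < constC c η ∧
        ∃ Dη : ℝ, 0 < Dη ∧
          ∀ (n : ℕ) (μ : Fin n → ℝ) (p : Fin n → H →L[ℂ] H), IsSpectralDecomposition η μ p →
          ∀ D₁ D₂ : H →L[ℂ] H, tr D₁ = 0 → tr D₂ = 0 → ‖D₁‖ ≤ Dη → ‖D₂‖ ≤ Dη →
            HasLog (η + D₁) ∧ HasLog (η + D₂) ∧
            ‖relEntropy (η + D₁) (η + D₂) - quadF μ p (D₁ - D₂)‖ ≤
              constC c η * (‖D₁‖ + ‖D₂‖) ^ 3 := by
  -- The radius `infSp η / 2` serves twice: it keeps `‖η + D - 1‖ < 1`, and it gives `‖V‖ ≤ 2/m`.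
  refine ⟨10, by norm_num, fun H _ _ _ _ η hη => ⟨hη.constC_pos (by norm_num), infSp η / 2,
    half_pos hη.infSp_pos, fun n μ p h D₁ D₂ h₁ h₂ hD₁ hD₂ => ?_⟩⟩
  have hm := hη.infSp_pos
  have hm1 := hη.infSp_le_one
  have hμ : ∀ i, infSp η ≤ μ i := fun i =>
    csInf_le (isCompact_spectrum_real η).bddBelow (h.mem_spectrum i)
  have hμ1 : ∀ i, μ i ≤ 1 := fun i =>
    hη.le_one_of_hasEigenvalue ((mem_spectrum_real_iff_hasEigenvalue η _).mp (h.mem_spectrum i))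
  exact ⟨h.hasLog_add hm hm1 hμ hμ1 hD₁, h.hasLog_add hm hm1 hμ hμ1 hD₂,
    (h.norm_relEntropy_sub_quadF_le hm hm1 hμ hμ1 h₁ h₂ hD₁ hD₂).trans
      (finrank_mul_le_constC hη (by positivity))⟩
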